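/- **Setting.** Let $(R,\mathfrak m)$ be a Noetherian local ring of dimension $d\ge 1$ with infinite residue field, let $s\ge 1$, and let $I_1,\dots,I_s$ be $\mathfrak m$-primary ideals of $R$ with $\operatorname{grade}(I_1\cdots I_s)\ge 1$. Put ${\bf e}=(1,\dots,1)\in\mathbb Z^s$, order $\mathbb Z^s$ componentwise, and write ${\bf I}^{\bf n}=I_1^{n_1}\cdots I_s^{n_s}$ for ${\bf n}\in\mathbb Z^s$, where $I_i^{n_i}=R$ if $n_i\le 0$. Let ${\bf n}^+=(\max\{0,n_1\},\dots,\max\{0,n_s\})$. Let $\mathcal F=\{\mathcal F({\bf n})\}_{{\bf n}\in\mathbb Z^s}$ be an ${\bf I}$-admissible filtration of ideals of $R$, that is: ${\bf I}^{\bf n}\subseteq\mathcal F({\bf n})$ and $\mathcal F({\bf n})\mathcal F({\bf m})\subseteq\mathcal F({\bf n}+{\bf m})$ for all ${\bf m},{\bf n}$; $\mathcal F({\bf m})\subseteq\mathcal F({\bf n})$ whenever ${\bf m}\ge{\bf n}$; $\mathcal F({\bf n})=\mathcal F({\bf n}^+)$ for all ${\bf n}$; and the extended Rees ring $\bigoplus_{{\bf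 n}\in\mathbb Z^s}\mathcal F({\bf n}){\bf t}^{\bf n}$ is a finite module over $\bigoplus_{{\bf n}\in\mathbb Z^s}{\bf I}^{\bf n}{\bf t}^{\bf n}$. Let $G({\bf I})=\bigoplus_{{\bf n}\in\mathbb N^s}{\bf I}^{\bf n}/{\bf I}^{{\bf n}+{\bf e}}$, a commutative $\mathbb N^s$-graded ring, and $G(\mathcal F)=\bigoplus_{{\bf n}\in\mathbb N^s}\mathcal F({\bf n})/\mathcal F({\bf n}+{\bf e})$, a graded $G({\bf I})$-module. For a graded $G({\bf I})$-module $M=\bigoplus_{{\bf n}\in\mathbb N^s} M_{\bf n}$, a homogeneous element $f\in G({\bf I})$ is called $M$-filter-regular if there is ${\bf N}\in\mathbb N^s$ such that $(0:_M f)_{\bf n}=0$ for all ${\bf n}\ge{\bf N}$; a sequence $f_1,\dots,f_r$ of homogeneous elements is called $M$-filter-regular if $f_i$ is $M/(f_1,\dots,f_{i-1})M$-filter-regular for every $i=1,\dots,r$. Let $a_{ij}\in I_i$ ($1\le i\le s$, $1\le j\le d$) form a complete reduction of $\mathcal F$: with $y_j=a_{1j}\cdots a_{sj}$, there is ${\bf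 m}\in\mathbb N^s$ such that $(y_1,\dots,y_d)\mathcal F({\bf n})=\mathcal F({\bf n}+{\bf e})$ for all ${\bf n}\ge{\bf m}$. Let $y_j^*=y_j+{\bf I}^{2{\bf e}}\in G({\bf I})_{\bf e}$ for $j=1,\dots,d$, and let $\mathfrak a=(y_1^*,\dots,y_d^*)\subseteq G({\bf I})$. **Theorem.** There exist $f_1,\dots,f_d\in\mathfrak a_{\bf e}=\mathfrak a\cap G({\bf I})_{\bf e}$ such that $f_1,\dots,f_d$ is a $G(\mathcal F)$-filter-regular sequence and $(y_1^*,\dots,y_d^*)=(f_1,\dots,f_d)$ as ideals of $G({\bf I})$. -/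

import Mathlib

noncomputable section

open scoped DirectSum

namespace MultiFilt

variable {R : Type*} [CommRing R] {s : ℕ}

/-- `I` is `P`-primary: it is a primary ideal whose radical is `P`. -/
def IsPrimaryTo (I P : Ideal R) : Prop :=
  I.IsPrimary ∧ I.radical = P

/-- The grade of an ideal: the supremum of the lengths of the `R`-regular sequences of elements
of the ideal. -/
def grade (I : Ideal R) : ℕ∞ :=
  ⨆ rs : {rs : List R // RingTheory.Sequence.IsRegular R rs ∧ ∀ r ∈ rs, r ∈ I},
    (rs.1.length : ℕ∞)

/-- The product `I₁ ^ n₁ ⋯ Iₛ ^ nₛ` for `n ∈ ℤˢ`, where nonpositive powers are the unit ideal. -/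
def multiPow (I : Fin s → Ideal R) (n : Fin s → ℤ) : Ideal R :=
  ∏ i, I i ^ (n i).toNat

/-- A `ℤˢ`-graded `I`-filtration of ideals. -/
structure Filtration (I : Fin s → Ideal R) where
  toFun : (Fin s → ℤ) → Ideal R
  pow_le : ∀ n, multiPow I n ≤ toFun n
  mul_le : ∀ m n, toFun n * toFun m ≤ toFun (n + m)
  anti : ∀ m n, n ≤ m → toFun m ≤ toFun n

instance (I : Fin s → Ideal R) : CoeFun (Filtration I) (fun _ => (Fin s → ℤ) → Ideal R) :=
  ⟨Filtration.toFun⟩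

theorem multiPow_anti (I : Fin s → Ideal R) {m n : Fin s → ℤ} (h : n ≤ m) :
    multiPow I m ≤ multiPow I n :=
  Finset.prod_le_prod' fun i _ => Ideal.pow_le_pow_right (Int.toNat_le_toNat (h i))

theorem multiPow_mul_le (I : Fin s → Ideal R) (m n : Fin s → ℤ) :
    multiPow I n * multiPow I m ≤ multiPow I (n + m) := by
  unfold multiPow
  rw [← Finset.prod_mul_distrib]
  refine Finset.prod_le_prod' fun i _ => ?_
  rw [← pow_add]
  refine Ideal.pow_le_pow_right ?_
  simp only [Pi.add_apply]
  omega

/-- The filtration `{I₁ ^ n₁ ⋯ Iₛ ^ nₛ}` of the products of powers. -/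
def powFiltration (I : Fin s → Ideal R) : Filtration I where
  toFun := multiPow I
  pow_le _ := le_rfl
  mul_le m n := multiPow_mul_le I m n
  anti _ _ h := multiPow_anti I h

/-- The inclusion `ℕˢ ⊆ ℤˢ`. -/
def toZ (n : Fin s → ℕ) : Fin s → ℤ := fun i => (n i : ℤ)

theorem toZ_zero : toZ (0 : Fin s → ℕ) = 0 := by
  funext i; simp [toZ]

theorem toZ_one : toZ (1 : Fin s → ℕ) = 1 := by
  funext i; simp [toZ]

theorem toZ_add (m n : Fin s → ℕ) : toZ (m + n) = toZ m + toZ n := by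
  funext i; simp [toZ]

namespace Filtration

variable {I : Fin s → Ideal R}

theorem zero_eq_top (F : Filtration I) : F 0 = ⊤ := by
  have h := F.pow_le 0
  have h1 : multiPow I (0 : Fin s → ℤ) = ⊤ := by simp [multiPow]
  rw [h1] at h
  exact top_le_iff.mp h

theorem mul_mem (F : Filtration I) {m n : Fin s → ℤ} {x y : R} (hx : x ∈ F m) (hy : y ∈ F n) :
    x * y ∈ F (m + n) :=
  F.mul_le n m (Ideal.mul_mem_mul hx hy)

theorem pow_mul_mem (F : Filtration I) {m n : Fin s → ℤ} {x y : R}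
    (hx : x ∈ powFiltration I m) (hy : y ∈ F n) : x * y ∈ F (m + n) :=
  F.mul_mem (F.pow_le m hx) hy

/-- The extended Rees ring `⨁ F(n) tⁿ`, `n ∈ ℤˢ`, as the subring of the Laurent polynomial ring
`R[t₁^{±1}, …, tₛ^{±1}]` of those elements whose coefficient of `tⁿ` lies in `F(n)`. -/
def extRees (F : Filtration I) : Subalgebra R (AddMonoidAlgebra R (Fin s → ℤ)) where
  carrier := {p | ∀ n, p.coeff n ∈ F n}
  mul_mem' {p q} hp hq n := by
    classical
    rw [AddMonoidAlgebra.coeff_mul]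
    refine Ideal.sum_mem _ fun a _ => Ideal.sum_mem _ fun b _ => ?_
    dsimp only
    split_ifs with h
    · rw [← h]
      exact F.mul_mem (hp a) (hq b)
    · exact zero_mem _
  add_mem' {p q} hp hq n := by
    rw [AddMonoidAlgebra.coeff_add]
    exact add_mem (hp n) (hq n)
  algebraMap_mem' r n := by
    classical
    rw [AddMonoidAlgebra.coe_algebraMap]
    simp only [Function.comp_apply, AddMonoidAlgebra.coeff_single, Finsupp.single_apply]
    split_ifs with h
    · rw [← h, F.zero_eq_top]
      trivial
    · exact zero_mem _

theorem extRees_pow_le (F : Filtration I) : (powFiltration I).extRees ≤ F.extRees :=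
  fun _ hp n => F.pow_le n (hp n)

/-- An `I`-admissible filtration: `F(n) = F(n⁺)` for all `n`, and the extended Rees ring of `F` is
a finite module over the extended Rees ring of the powers of `I`. -/
structure IsAdmissible (F : Filtration I) : Prop where
  eq_pos : ∀ n, F n = F (n ⊔ 0)
  finite : (Subalgebra.inclusion F.extRees_pow_le).toRingHom.Finite

/-- The family `a i j` (`i = 1, …, s`, `j = 1, …, d`) is a complete reduction of `F`. -/
structure IsCompleteReduction {d : ℕ} (F : Filtration I) (a : Fin s → Fin d → R) : Prop where
  mem : ∀ i j, a i j ∈ I i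
  exists_eq : ∃ m : Fin s → ℕ, ∀ n : Fin s → ℤ, toZ m ≤ n →
    Ideal.span (Set.range fun j => ∏ i, a i j) * F n = F (n + 1)

/-- The graded piece `F(n) / F(n + e)`, where `e = (1, …, 1)`. -/
abbrev piece (F : Filtration I) (n : Fin s → ℕ) : Type _ :=
  F (toZ n) ⧸ (F (toZ n + 1)).submoduleOf (F (toZ n))

/-- The class in `F(n) / F(n + e)` of an element of `F(n)`. -/
def cls (F : Filtration I) (n : Fin s → ℕ) (x : R) (hx : x ∈ F (toZ n)) : F.piece n :=
  Submodule.Quotient.mk ⟨x, hx⟩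

theorem cls_eq_iff (F : Filtration I) {n : Fin s → ℕ} {x y : R} (hx : x ∈ F (toZ n))
    (hy : y ∈ F (toZ n)) : F.cls n x hx = F.cls n y hy ↔ x - y ∈ F (toZ n + 1) := by
  unfold cls
  rw [Submodule.Quotient.eq]
  rfl

theorem cls_surj (F : Filtration I) {n : Fin s → ℕ} (z : F.piece n) :
    ∃ x, ∃ hx : x ∈ F (toZ n), F.cls n x hx = z := by
  obtain ⟨⟨x, hx⟩, rfl⟩ := Submodule.Quotient.mk_surjective _ z
  exact ⟨x, hx, rfl⟩

theorem mk_cls_congr (F : Filtration I) {m n : Fin s → ℕ} (h : m = n) {x y : R} (hxy : x = y)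
    (hx : x ∈ F (toZ m)) (hy : y ∈ F (toZ n)) :
    GradedMonoid.mk (A := F.piece) m (F.cls m x hx) = GradedMonoid.mk n (F.cls n y hy) := by
  subst h; subst hxy; rfl

theorem add_one_mem_left (F : Filtration I) {m n : Fin s → ℕ} {x y : R}
    (hx : x ∈ powFiltration I (toZ m + 1)) (hy : y ∈ F (toZ n)) :
    x * y ∈ F (toZ (m + n) + 1) := by
  have h := F.pow_mul_mem hx hy
  rwa [show toZ m + 1 + toZ n = toZ (m + n) + 1 by rw [toZ_add]; abel] at h

theorem add_one_mem_right (F : Filtration I) {m n : Fin s → ℕ} {x y : R}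
    (hx : x ∈ powFiltration I (toZ m)) (hy : y ∈ F (toZ n + 1)) :
    x * y ∈ F (toZ (m + n) + 1) := by
  have h := F.pow_mul_mem hx hy
  rwa [show toZ m + (toZ n + 1) = toZ (m + n) + 1 by rw [toZ_add]; abel] at h

theorem add_mem (F : Filtration I) {m n : Fin s → ℕ} {x y : R}
    (hx : x ∈ powFiltration I (toZ m)) (hy : y ∈ F (toZ n)) :
    x * y ∈ F (toZ (m + n)) := by
  rw [toZ_add]
  exact F.pow_mul_mem hx hy

/-- The multiplication `I^m / I^{m+e} × F(n) / F(n+e) → F(m+n) / F(m+n+e)` induced by that of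
`R`. -/
def pieceMul (F : Filtration I) {m n : Fin s → ℕ} (a : (powFiltration I).piece m)
    (b : F.piece n) : F.piece (m + n) :=
  Quotient.liftOn₂' a b
    (fun x y => F.cls (m + n) (x.1 * y.1) (F.add_mem x.2 y.2)) <| by
      rintro ⟨x, hx⟩ ⟨y, hy⟩ ⟨x', hx'⟩ ⟨y', hy'⟩ h1 h2
      rw [Submodule.quotientRel_def] at h1 h2
      rw [cls_eq_iff]
      have h1' : x - x' ∈ powFiltration I (toZ m + 1) := h1
      have h2' : y - y' ∈ F (toZ n + 1) := h2
      have e : x * y - x' * y' = (x - x') * y + x' * (y - y') := by ring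
      rw [e]
      exact Ideal.add_mem _ (F.add_one_mem_left h1' hy) (F.add_one_mem_right hx' h2')

theorem pieceMul_cls (F : Filtration I) {m n : Fin s → ℕ} {x y : R}
    (hx : x ∈ powFiltration I (toZ m)) (hy : y ∈ F (toZ n)) :
    F.pieceMul ((powFiltration I).cls m x hx) (F.cls n y hy) =
      F.cls (m + n) (x * y) (F.add_mem hx hy) := rfl

theorem cls_add (F : Filtration I) {n : Fin s → ℕ} {x y : R} (hx : x ∈ F (toZ n))
    (hy : y ∈ F (toZ n)) :
    F.cls n x hx + F.cls n y hy = F.cls n (x + y) (Ideal.add_mem _ hx hy) := rfl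

theorem cls_zero (F : Filtration I) (n : Fin s → ℕ) :
    F.cls n 0 (Ideal.zero_mem _) = 0 := rfl

theorem pieceMul_add (F : Filtration I) {m n : Fin s → ℕ} (a : (powFiltration I).piece m)
    (b c : F.piece n) : F.pieceMul a (b + c) = F.pieceMul a b + F.pieceMul a c := by
  obtain ⟨x, hx, rfl⟩ := cls_surj _ a
  obtain ⟨y, hy, rfl⟩ := cls_surj _ b
  obtain ⟨z, hz, rfl⟩ := cls_surj _ c
  rw [cls_add, pieceMul_cls, pieceMul_cls, pieceMul_cls, cls_add, cls_eq_iff]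
  rw [show x * (y + z) - (x * y + x * z) = 0 by ring]
  exact Ideal.zero_mem _

theorem add_pieceMul (F : Filtration I) {m n : Fin s → ℕ} (a b : (powFiltration I).piece m)
    (c : F.piece n) : F.pieceMul (a + b) c = F.pieceMul a c + F.pieceMul b c := by
  obtain ⟨x, hx, rfl⟩ := cls_surj _ a
  obtain ⟨y, hy, rfl⟩ := cls_surj _ b
  obtain ⟨z, hz, rfl⟩ := cls_surj _ c
  rw [cls_add, pieceMul_cls, pieceMul_cls, pieceMul_cls, cls_add, cls_eq_iff]
  rw [show (x + y) * z - (x * z + y * z) = 0 by ring]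
  exact Ideal.zero_mem _

theorem pieceMul_zero (F : Filtration I) {m n : Fin s → ℕ} (a : (powFiltration I).piece m) :
    F.pieceMul a (0 : F.piece n) = 0 := by
  have h := F.pieceMul_add a (0 : F.piece n) 0
  rw [add_zero] at h
  exact left_eq_add.mp h

theorem zero_pieceMul (F : Filtration I) {m n : Fin s → ℕ} (c : F.piece n) :
    F.pieceMul (0 : (powFiltration I).piece m) c = 0 := by
  have h := F.add_pieceMul (0 : (powFiltration I).piece m) 0 c
  rw [add_zero] at h
  exact left_eq_add.mp h

theorem mem_zero (F : Filtration I) (x : R) : x ∈ F (toZ 0) := by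
  rw [toZ_zero, F.zero_eq_top]
  trivial

end Filtration

open Filtration

variable (I : Fin s → Ideal R)

instance gOne : GradedMonoid.GOne (powFiltration I).piece where
  one := (powFiltration I).cls 0 1 (mem_zero _ _)

instance gMul : GradedMonoid.GMul (powFiltration I).piece where
  mul a b := (powFiltration I).pieceMul a b

/-- The graded pieces `I^n / I^{n+e}` form a graded monoid. -/
instance gMonoid : GradedMonoid.GMonoid (powFiltration I).piece where
  __ := gOne I
  __ := gMul I
  one_mul := by
    rintro ⟨n, a⟩
    obtain ⟨x, hx, rfl⟩ := cls_surj _ a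
    exact mk_cls_congr _ (zero_add n) (one_mul x) _ _
  mul_one := by
    rintro ⟨n, a⟩
    obtain ⟨x, hx, rfl⟩ := cls_surj _ a
    exact mk_cls_congr _ (add_zero n) (mul_one x) _ _
  mul_assoc := by
    rintro ⟨l, a⟩ ⟨m, b⟩ ⟨n, c⟩
    obtain ⟨x, hx, rfl⟩ := cls_surj _ a
    obtain ⟨y, hy, rfl⟩ := cls_surj _ b
    obtain ⟨z, hz, rfl⟩ := cls_surj _ c
    exact mk_cls_congr _ (add_assoc l m n) (mul_assoc x y z) _ _

/-- The graded pieces `I^n / I^{n+e}` form a commutative graded ring. -/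
instance gCommRing : DirectSum.GCommRing (powFiltration I).piece where
  __ := gMonoid I
  mul_zero a := pieceMul_zero _ a
  zero_mul b := zero_pieceMul _ b
  mul_add a b c := pieceMul_add _ a b c
  add_mul a b c := add_pieceMul _ a b c
  mul_comm := by
    rintro ⟨m, a⟩ ⟨n, b⟩
    obtain ⟨x, hx, rfl⟩ := cls_surj _ a
    obtain ⟨y, hy, rfl⟩ := cls_surj _ b
    exact mk_cls_congr _ (add_comm m n) (mul_comm x y) _ _
  natCast k := (powFiltration I).cls 0 k (mem_zero _ _)
  natCast_zero := by
    rw [← cls_zero, cls_eq_iff]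
    simp
  natCast_succ k := by
    change _ = (powFiltration I).cls 0 (k : R) (mem_zero _ _) +
      (powFiltration I).cls 0 1 (mem_zero _ _)
    rw [cls_add, cls_eq_iff]
    simp
  intCast k := (powFiltration I).cls 0 k (mem_zero _ _)
  intCast_ofNat k := by
    rw [cls_eq_iff]
    simp
  intCast_negSucc_ofNat k := by
    change _ = -(powFiltration I).cls 0 ((k + 1 : ℕ) : R) (mem_zero _ _)
    rw [eq_neg_iff_add_eq_zero, cls_add, ← cls_zero, cls_eq_iff]
    simp

/-- The graded pieces `F(n) / F(n+e)` form a graded module over the graded ring of the pieces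
`I^n / I^{n+e}`. -/
instance gmodule (F : Filtration I) :
    DirectSum.Gmodule (powFiltration I).piece F.piece where
  smul a b := F.pieceMul a b
  one_smul := by
    rintro ⟨n, a⟩
    obtain ⟨x, hx, rfl⟩ := cls_surj _ a
    exact mk_cls_congr _ (zero_add n) (one_mul x) _ _
  mul_smul := by
    rintro ⟨l, a⟩ ⟨m, b⟩ ⟨n, c⟩
    obtain ⟨x, hx, rfl⟩ := cls_surj _ a
    obtain ⟨y, hy, rfl⟩ := cls_surj _ b
    obtain ⟨z, hz, rfl⟩ := cls_surj _ c
    exact mk_cls_congr _ (add_assoc l m n) (mul_assoc x y z) _ _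
  smul_add a b c := pieceMul_add _ a b c
  smul_zero a := pieceMul_zero _ a
  add_smul a b c := add_pieceMul _ a b c
  zero_smul b := zero_pieceMul _ b

variable {I}

/-- The associated multigraded object `G(F) = ⨁ F(n) / F(n+e)`, `n ∈ ℕˢ`. -/
abbrev Filtration.G (F : Filtration I) : Type _ :=
  ⨁ n : Fin s → ℕ, F.piece n

/-- The component of degree `n` of `G(F)`. -/
def Filtration.comp (F : Filtration I) (n : Fin s → ℕ) : AddSubgroup F.G :=
  (DirectSum.of F.piece n).range

variable (I) in
/-- The associated multigraded ring `G(I) = ⨁ I^n / I^{n+e}`, `n ∈ ℕˢ`. It acts on `G(F)` for every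
`I`-filtration `F`. -/
abbrev GI : Type _ := (powFiltration I).G

theorem prod_mem_multiPow {d : ℕ} {a : Fin s → Fin d → R} (ha : ∀ i j, a i j ∈ I i) (j : Fin d) :
    ∏ i, a i j ∈ powFiltration I (toZ 1) := by
  have h : powFiltration I (toZ 1) = ∏ i, I i := by
    simp [powFiltration, multiPow, toZ]
  rw [h]
  exact Ideal.prod_mem_prod fun i _ => ha i j

/-- The element `y_j* = y_j + I^{2e} ∈ G(I)_e` for `y_j = a_{1j} ⋯ a_{sj}`. -/
def yStar {d : ℕ} {a : Fin s → Fin d → R} (ha : ∀ i j, a i j ∈ I i) (j : Fin d) : GI I :=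
  DirectSum.of (powFiltration I).piece 1
    ((powFiltration I).cls 1 (∏ i, a i j) (prod_mem_multiPow ha j))

section FilterRegular

variable {A M : Type*} [CommRing A] [AddCommGroup M] [Module A M]

/-- Given the graded components `𝒜 n` of `A` and `ℳ n` of `M` (`n ∈ ℕˢ`), the element `a ∈ A` is
`M`-filter-regular: it is homogeneous, and `(0 :_M a)_n = 0` for all large `n`. -/
def IsFilterRegular (𝒜 : (Fin s → ℕ) → AddSubgroup A) (ℳ : (Fin s → ℕ) → AddSubgroup M) (a : A) :
    Prop :=
  (∃ k, a ∈ 𝒜 k) ∧ ∃ N : Fin s → ℕ, ∀ n, N ≤ n → ∀ x ∈ ℳ n, a • x = 0 → x = 0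

/-- `f₁, …, f_r` is an `M`-filter-regular sequence: each `f_i` is filter-regular on
`M / (f₁, …, f_{i-1}) M`, graded by the images of the components of `M`. -/
def IsFilterRegularSeq (𝒜 : (Fin s → ℕ) → AddSubgroup A) (ℳ : (Fin s → ℕ) → AddSubgroup M)
    {r : ℕ} (f : Fin r → A) : Prop :=
  ∀ i : Fin r,
    IsFilterRegular
      (M := M ⧸ (Ideal.span (f '' {j | j < i}) • ⊤ : Submodule A M)) 𝒜
      (fun n => (ℳ n).map
        (Ideal.span (f '' {j | j < i}) • ⊤ : Submodule A M).mkQ.toAddMonoidHom)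
      (f i)

end FilterRegular

end MultiFilt

end

/-! Write `J` for the ideal of the y_j* in G(I). Two facts combine.

Avoidance: G(I) is Noetherian and G(F) is finite over it, so M = G(F)/(f_1, …, f_{i-1})G(F) has
finitely many associated primes. The coefficient vectors of the R-combinations of the y_j* falling
into a given prime that does not contain `J` form a proper submodule of R^d. As the residue field is
infinite, some vector avoids all of these and also stays independent, modulo the maximal ideal, of
the vectors already chosen. After d choices the vectors generate R^d by Nakayama, so the f_i
generate `J`. Each f_i lies only in associated primes containing `J`, so a power of `J` kills (0 :_M
f_i), and Artin–Rees gives J^q M ∩ (0 :_M f_i) = 0 for some q (`exists_powSmulTop_inf_ker_eq_bot`).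

Degrees: iterating the reduction equation q times puts every component of G(F) of degree at least qe
+ m inside J^q G(F) (`IsCompleteReduction.of_mem_powSmulTop`). Hence (0 :_M f_i) vanishes in those
degrees. -/

noncomputable section

open scoped DirectSum

namespace MultiFilt

/-! ### Prime avoidance and general linear combinations -/

section Avoidance

/-- The submodule `J ^ q M` of `M`. -/
def powSmulTop {A : Type*} (M : Type*) [CommRing A] [AddCommGroup M] [Module A M] (J : Ideal A)
    (q : ℕ) : Submodule A M :=
  J ^ q • ⊤

theorem mem_powSmulTop_zero {A M : Type*} [CommRing A] [AddCommGroup M] [Module A M]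
    (J : Ideal A) (x : M) : x ∈ powSmulTop M J 0 := by
  rw [powSmulTop, pow_zero, Ideal.one_eq_top, Submodule.top_smul]
  exact Submodule.mem_top

theorem smul_mem_powSmulTop_succ {A M : Type*} [CommRing A] [AddCommGroup M] [Module A M]
    {J : Ideal A} {r : A} (hr : r ∈ J) {q : ℕ} {x : M} (hx : x ∈ powSmulTop M J q) :
    r • x ∈ powSmulTop M J (q + 1) := by
  rw [powSmulTop, pow_succ', Submodule.mul_smul]
  exact Submodule.smul_mem_smul hr hx

theorem mkQ_mem_powSmulTop {A M : Type*} [CommRing A] [AddCommGroup M] [Module A M] {J : Ideal A}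
    (K : Submodule A M) {q : ℕ} {x : M} (hx : x ∈ powSmulTop M J q) :
    K.mkQ x ∈ powSmulTop (M ⧸ K) J q := by
  have h := Submodule.mem_map_of_mem (f := K.mkQ) hx
  rw [powSmulTop, Submodule.map_smul''] at h
  exact Submodule.smul_mono le_rfl le_top h

/-- If `f` avoids the associated primes of `M` not containing `J`, then some power of `J` times `M`
contains no nonzero element killed by `f`. -/
theorem exists_powSmulTop_inf_ker_eq_bot {A M : Type*} [CommRing A] [IsNoetherianRing A]
    [AddCommGroup M] [Module A M] [Module.Finite A M] (J : Ideal A) (f : A)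
    (hf : ∀ P ∈ associatedPrimes A M, f ∈ P → J ≤ P) :
    ∃ q : ℕ, ∀ x ∈ powSmulTop M J q, f • x = 0 → x = 0 := by
  set N : Submodule A M := LinearMap.ker (LinearMap.lsmul A M f) with hN
  have hmem : ∀ x, x ∈ N ↔ f • x = 0 := fun x => by simp [hN]
  -- A minimal prime over the annihilator of `N` is associated to `N`, hence to `M`, and it contains
  -- `f` because `f` kills `N`; by hypothesis it then contains `J`.
  have hrad : J ≤ (Module.annihilator A N).radical := by
    rw [← Ideal.sInf_minimalPrimes]
    refine le_sInf fun P hP => ?_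
    have hP' := Module.associatedPrimes.minimalPrimes_annihilator_subset_associatedPrimes A N hP
    refine hf P (associatedPrimes.subset_of_injective N.injective_subtype hP') ?_
    refine hP.1.2 (Module.mem_annihilator.2 fun x => Subtype.ext ?_)
    exact (hmem _).1 x.2
  obtain ⟨k, hk⟩ := Ideal.exists_pow_le_of_le_radical_of_fg hrad (IsNoetherian.noetherian J)
  -- Artin–Rees: past exponent `c`, the intersection with `N` lies in `J ^ k • N`, which is zero by
  -- the choice of `k`.
  obtain ⟨c, hc⟩ := Ideal.exists_pow_inf_eq_pow_smul J N
  refine ⟨c + k, fun x hx hfx => ?_⟩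
  have hx' : x ∈ (J ^ (c + k) • ⊤ ⊓ N : Submodule A M) := ⟨hx, (hmem x).2 hfx⟩
  rw [hc _ (Nat.le_add_right c k), Nat.add_sub_cancel_left] at hx'
  have hx'' : x ∈ (J ^ k • N : Submodule A M) := Submodule.smul_mono le_rfl inf_le_right hx'
  refine (Submodule.mem_bot A).1 (Submodule.smul_le.2 (fun r hr n hn => ?_) hx'')
  have := Module.mem_annihilator.1 (hk hr) ⟨n, hn⟩
  exact (Submodule.mem_bot A).2 (congrArg Subtype.val this)

open IsLocalRing

variable {R : Type*} [CommRing R] [IsLocalRing R] {d : ℕ}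

/-- Coordinatewise reduction modulo the maximal ideal. -/
def residuePi (R : Type*) [CommRing R] [IsLocalRing R] (d : ℕ) :
    (Fin d → R) →ₗ[R] (Fin d → ResidueField R) :=
  LinearMap.compLeft (Algebra.linearMap R (ResidueField R)) (Fin d)

theorem residuePi_apply (v : Fin d → R) (j : Fin d) : residuePi R d v j = residue R (v j) := rfl

theorem residuePi_surjective : Function.Surjective (residuePi R d) := by
  intro w
  choose v hv using fun j => residue_surjective (w j)
  exact ⟨v, funext hv⟩

/-- Nakayama's lemma for submodules of `R ^ d`. -/
theorem eq_top_of_span_residuePi_eq_top (W : Submodule R (Fin d → R))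
    (h : Submodule.span (ResidueField R) (residuePi R d '' W) = ⊤) : W = ⊤ := by
  have h1 : W.map (residuePi R d) = ⊤ := by
    have := Submodule.restrictScalars_span R (ResidueField R) residue_surjective
      (residuePi R d '' W)
    rw [h, Submodule.restrictScalars_top, Submodule.span_image, Submodule.span_eq] at this
    exact this.symm
  refine top_le_iff.1 (Submodule.le_of_le_smul_of_le_jacobson_bot (I := maximalIdeal R)
    Module.Finite.fg_top (maximalIdeal_le_jacobson _) fun v _ => ?_)
  obtain ⟨w, hw, hwv⟩ : residuePi R d v ∈ W.map (residuePi R d) := h1 ▸ Submodule.mem_top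
  have hz : ∀ j, (v - w) j ∈ maximalIdeal R := fun j => by
    rw [← residue_eq_zero_iff, ← residuePi_apply, map_sub, hwv, sub_self, Pi.zero_apply]
  rw [← add_sub_cancel w v]
  refine Submodule.add_mem_sup hw ?_
  rw [pi_eq_sum_univ' (v - w)]
  exact Submodule.sum_mem _ fun j _ => Submodule.smul_mem_smul (hz j) Submodule.mem_top

/-- Over a local ring with infinite residue field, a vector of `R ^ d` can be chosen outside of
finitely many proper submodules and so that it extends a given family of fewer than `d` vectors
that are linearly independent modulo the maximal ideal. -/
theorem exists_linearIndependent_snoc_notMem [Infinite (ResidueField R)] {r : ℕ} (hr : r < d)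
    {v : Fin r → Fin d → R} (hv : LinearIndependent (ResidueField R) fun i => residuePi R d (v i))
    {𝒲 : Set (Submodule R (Fin d → R))} (hfin : 𝒲.Finite) (htop : ⊤ ∉ 𝒲) :
    ∃ w : Fin d → R, (∀ W ∈ 𝒲, w ∉ W) ∧
      LinearIndependent (ResidueField R)
        fun i => residuePi R d ((Fin.snoc v w : Fin (r + 1) → Fin d → R) i) := by
  classical
  set S := Submodule.span (ResidueField R) (Set.range fun i => residuePi R d (v i)) with hS
  have hStop : S ≠ ⊤ := by
    intro h
    have h1 := finrank_range_le_card (R := ResidueField R) fun i => residuePi R d (v i)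
    rw [Set.finrank, ← hS, h, finrank_top, Module.finrank_fin_fun, Fintype.card_fin] at h1
    omega
  -- The span `S` of the earlier vectors joins the list of proper subspaces to avoid; avoiding it is
  -- what gives linear independence.
  have hfin' := (hfin.image
    fun W : Submodule R (Fin d → R) => Submodule.span (ResidueField R) (residuePi R d '' W)).insert S
  have hne := Subspace.biUnion_ne_univ_of_top_notMem (k := ResidueField R)
    (s := hfin'.toFinset) (by
      rw [Set.Finite.mem_toFinset]
      rintro (h | ⟨W, hW, h⟩)
      · exact hStop h.symm
      · exact htop (eq_top_of_span_residuePi_eq_top W h ▸ hW))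
  obtain ⟨u, hu⟩ := (Set.ne_univ_iff_exists_notMem _).1 hne
  obtain ⟨w, rfl⟩ := residuePi_surjective u
  simp only [Set.Finite.mem_toFinset, Set.mem_iUnion, not_exists] at hu
  refine ⟨w, fun W hW hw => ?_, ?_⟩
  · exact hu _ (Set.mem_insert_of_mem _ ⟨W, hW, rfl⟩) (Submodule.subset_span ⟨w, hw, rfl⟩)
  · have : (fun i => residuePi R d ((Fin.snoc v w : Fin (r + 1) → Fin d → R) i)) =
        Fin.snoc (fun i => residuePi R d (v i)) (residuePi R d w) := by
      funext i
      refine Fin.lastCases ?_ (fun i => ?_) i <;> simp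
    rw [this]
    exact hv.finSnoc (hu S (Set.mem_insert _ _))

theorem snoc_image_lt_castSucc {X Y : Type*} {r : ℕ} (v : Fin r → X) (w : X) (g : X → Y)
    (i : Fin r) :
    (fun j => g ((Fin.snoc v w : Fin (r + 1) → X) j)) '' {j | j < i.castSucc} =
      (fun j => g (v j)) '' {j | j < i} := by
  ext y
  constructor
  · rintro ⟨j, hj, rfl⟩
    have hj' : (j : ℕ) < i := hj
    obtain ⟨j, rfl⟩ : ∃ j' : Fin r, j'.castSucc = j := ⟨⟨j, by omega⟩, rfl⟩
    exact ⟨j, hj', by simp⟩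
  · rintro ⟨j, hj, rfl⟩
    exact ⟨j.castSucc, hj, by simp⟩

/-- The induction carries coefficient vectors rather than elements of `A`: independence modulo the
maximal ideal is what later shows that the full sequence generates the ideal of the `y j`. -/
theorem exists_generic_sequence [Infinite (ResidueField R)] {A M : Type*} [CommRing A]
    [IsNoetherianRing A] [Algebra R A] [AddCommGroup M] [Module A M] [Module.Finite A M]
    (y : Fin d → A) (r : ℕ) (hr : r ≤ d) :
    ∃ v : Fin r → Fin d → R, LinearIndependent (ResidueField R) (fun i => residuePi R d (v i)) ∧
      ∀ i, ∃ q : ℕ, ∀ x : M ⧸ (Ideal.span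
        ((fun j => Fintype.linearCombination R y (v j)) '' {j | j < i}) • ⊤ : Submodule A M),
        x ∈ powSmulTop _ (Ideal.span (Set.range y)) q →
          Fintype.linearCombination R y (v i) • x = 0 → x = 0 := by
  induction r with
  | zero => exact ⟨Fin.elim0, linearIndependent_empty_type, fun i => i.elim0⟩
  | succ r ih =>
    obtain ⟨v, hv, hreg⟩ := ih (Nat.le_of_succ_le hr)
    set g := Fintype.linearCombination R y with hg
    set K : Submodule A M := Ideal.span (Set.range fun j => g (v j)) • ⊤ with hK
    -- Bad primes are pulled back to R^d. Such a pullback is proper: if it contained every unit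
    -- vector, the prime would contain every `y j`.
    obtain ⟨w, hw, hvw⟩ := exists_linearIndependent_snoc_notMem (Nat.lt_of_succ_le hr) hv
      (𝒲 := (fun P : Ideal A => (P.restrictScalars R).comap g) ''
        {P ∈ associatedPrimes A (M ⧸ K) | ¬ Ideal.span (Set.range y) ≤ P})
      (((associatedPrimes.finite A (M ⧸ K)).subset (Set.sep_subset _ _)).image _) (by
        rintro ⟨P, ⟨-, hP⟩, h⟩
        refine hP (Ideal.span_le.2 ?_)
        rintro _ ⟨j, rfl⟩
        have : Pi.single j (1 : R) ∈ (P.restrictScalars R).comap g :=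
          (Submodule.eq_top_iff'.1 h) _
        simpa [hg] using this)
    refine ⟨Fin.snoc v w, hvw, fun i => ?_⟩
    refine Fin.lastCases ?_ (fun i => ?_) i
    · have : (fun j => g ((Fin.snoc v w : Fin (r + 1) → Fin d → R) j)) '' {j | j < Fin.last r} =
          Set.range fun j => g (v j) := by
        ext z
        constructor
        · rintro ⟨j, hj, rfl⟩
          obtain ⟨j, rfl⟩ := Fin.exists_castSucc_eq.2 (ne_of_lt hj)
          exact ⟨j, by simp⟩
        · rintro ⟨j, rfl⟩
          exact ⟨j.castSucc, Fin.castSucc_lt_last j, by simp⟩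
      rw [this, Fin.snoc_last]
      refine exists_powSmulTop_inf_ker_eq_bot _ _ fun P hP hf => ?_
      by_contra hPy
      exact hw _ ⟨P, ⟨hP, hPy⟩, rfl⟩ hf
    · rw [snoc_image_lt_castSucc, Fin.snoc_castSucc]
      exact hreg i

/-- The ideal `J` generated by `y₁, …, y_d` is generated by a sequence `f₁, …, f_d` of general
`R`-linear combinations of the `y_j` such that the elements killed by `f_i` on
`M / (f₁, …, f_{i-1}) M` meet the submodule generated by a large power of `J` trivially. -/
theorem exists_generating_generic_sequence [Infinite (ResidueField R)] {A M : Type*} [CommRing A]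
    [IsNoetherianRing A] [Algebra R A] [AddCommGroup M] [Module A M] [Module.Finite A M]
    (y : Fin d → A) :
    ∃ f : Fin d → A, (∀ i, ∃ c : Fin d → R, f i = ∑ j, algebraMap R A (c j) * y j) ∧
      Ideal.span (Set.range y) = Ideal.span (Set.range f) ∧
      ∀ i, ∃ q : ℕ, ∀ x : M ⧸ (Ideal.span (f '' {j | j < i}) • ⊤ : Submodule A M),
        x ∈ powSmulTop _ (Ideal.span (Set.range y)) q → f i • x = 0 → x = 0 := by
  obtain ⟨v, hv, hreg⟩ := exists_generic_sequence (R := R) (M := M) y d le_rfl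
  set g := Fintype.linearCombination R y with hg
  have hgmem : ∀ u, g u ∈ Submodule.span R (Set.range y) := fun u => by
    rw [← Fintype.range_linearCombination]
    exact ⟨u, rfl⟩
  have hspan : Submodule.span R (Set.range v) = ⊤ := by
    refine eq_top_of_span_residuePi_eq_top _ (top_le_iff.1 ?_)
    rw [← hv.span_eq_top_of_card_eq_finrank' (by simp)]
    refine Submodule.span_mono ?_
    rintro _ ⟨i, rfl⟩
    exact ⟨v i, Submodule.subset_span ⟨i, rfl⟩, rfl⟩
  refine ⟨fun i => g (v i), fun i => ⟨v i, ?_⟩, le_antisymm ?_ ?_, hreg⟩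
  · simp only [hg, Fintype.linearCombination_apply, Algebra.smul_def]
  · refine Ideal.span_le.2 ?_
    rintro _ ⟨j, rfl⟩
    have h1 : Submodule.span R (Set.range v) ≤
        ((Ideal.span (Set.range fun i => g (v i))).restrictScalars R).comap g := by
      refine Submodule.span_le.2 ?_
      rintro _ ⟨i, rfl⟩
      exact Ideal.subset_span ⟨i, rfl⟩
    have h2 : Pi.single j (1 : R) ∈ Submodule.span R (Set.range v) := hspan ▸ Submodule.mem_top
    simpa [hg] using h1 h2
  · refine Ideal.span_le.2 ?_
    rintro _ ⟨i, rfl⟩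
    exact Submodule.span_le_restrictScalars R A _ (hgmem (v i))

end Avoidance

/-! ### Noetherianity of G(I) -/

variable {R : Type*} [CommRing R] {s : ℕ} {I : Fin s → Ideal R}

namespace Filtration

theorem of_cls_smul (F : Filtration I) {m n : Fin s → ℕ} {x y : R}
    (hx : x ∈ powFiltration I (toZ m)) (hy : y ∈ F (toZ n)) :
    (DirectSum.of (powFiltration I).piece m ((powFiltration I).cls m x hx) : GI I) •
      (DirectSum.of F.piece n (F.cls n y hy) : F.G) =
        DirectSum.of F.piece (m + n) (F.cls (m + n) (x * y) (F.add_mem hx hy)) :=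
  DirectSum.Gmodule.of_smul_of _ _ _ _

theorem of_cls_congr (F : Filtration I) {m n : Fin s → ℕ} (h : m = n) {x y : R} (hxy : x = y)
    (hx : x ∈ F (toZ m)) (hy : y ∈ F (toZ n)) :
    DirectSum.of F.piece m (F.cls m x hx) = DirectSum.of F.piece n (F.cls n y hy) := by
  subst h; subst hxy; rfl

/-- The elements of `F(n)` whose class in `G(F)` belongs to a given additive submonoid. -/
def clsComap (F : Filtration I) (B : AddSubmonoid F.G) (n : Fin s → ℕ) : AddSubmonoid R where
  carrier := {x | ∃ hx : x ∈ F (toZ n), DirectSum.of F.piece n (F.cls n x hx) ∈ B}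
  zero_mem' := ⟨Ideal.zero_mem _, by rw [cls_zero, map_zero]; exact B.zero_mem⟩
  add_mem' := by
    rintro x y ⟨hx, hx'⟩ ⟨hy, hy'⟩
    refine ⟨Ideal.add_mem _ hx hy, ?_⟩
    rw [← F.cls_add hx hy, map_add]
    exact B.add_mem hx' hy'

theorem eq_top_of_le_clsComap (F : Filtration I) {B : AddSubmonoid F.G}
    (h : ∀ n, ∀ x ∈ F (toZ n), x ∈ F.clsComap B n) : B = ⊤ := by
  refine B.eq_top_iff'.2 fun z => ?_
  induction z using DirectSum.induction_on with
  | zero => exact B.zero_mem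
  | of n z =>
    obtain ⟨x, hx, rfl⟩ := F.cls_surj z
    exact (h n x hx).2
  | add x y hx hy => exact B.add_mem hx hy

end Filtration

open Filtration

/-- The ring homomorphism `R → G(I)` onto the component of degree zero. -/
def toGI (I : Fin s → Ideal R) : R →+* GI I where
  toFun x := DirectSum.of (powFiltration I).piece 0 ((powFiltration I).cls 0 x (mem_zero _ _))
  map_one' := rfl
  map_zero' := by rw [cls_zero, map_zero]
  map_add' x y := by rw [← map_add, cls_add]
  map_mul' x y := by
    refine Eq.trans ?_ (of_cls_smul (powFiltration I) (mem_zero _ x) (mem_zero _ y)).symm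
    exact of_cls_congr _ (add_zero 0).symm rfl _ _

instance algebraGI (I : Fin s → Ideal R) : Algebra R (GI I) :=
  RingHom.toAlgebra (S := GI I) (toGI I)

/-- The additive submonoid underlying a subalgebra of `G(I)`. -/
def clsSubmonoid (B : Subalgebra R (GI I)) : AddSubmonoid (powFiltration I).G where
  carrier := B
  zero_mem' := B.zero_mem
  add_mem' := B.add_mem

theorem clsComap_mul_mem (B : Subalgebra R (GI I)) {m n : Fin s → ℕ} {x y : R}
    (hx : x ∈ (powFiltration I).clsComap (clsSubmonoid B) m)
    (hy : y ∈ (powFiltration I).clsComap (clsSubmonoid B) n) :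
    x * y ∈ (powFiltration I).clsComap (clsSubmonoid B) (m + n) := by
  obtain ⟨hx, hx'⟩ := hx
  obtain ⟨hy, hy'⟩ := hy
  refine ⟨Filtration.add_mem _ hx hy, ?_⟩
  rw [← of_cls_smul _ hx hy]
  exact B.mul_mem hx' hy'

/-- The elements of `I ^ n` whose class in `G(I)` belongs to a given subalgebra. -/
def clsIdeal (B : Subalgebra R (GI I)) (n : Fin s → ℕ) : Ideal R where
  __ := (powFiltration I).clsComap (clsSubmonoid B) n
  smul_mem' r x hx := by
    have hr : r ∈ (powFiltration I).clsComap (clsSubmonoid B) 0 :=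
      ⟨mem_zero _ _, B.algebraMap_mem r⟩
    have := clsComap_mul_mem B hr hx
    rwa [zero_add] at this

theorem clsIdeal_mul_le (B : Subalgebra R (GI I)) (m n : Fin s → ℕ) :
    clsIdeal B m * clsIdeal B n ≤ clsIdeal B (m + n) :=
  Ideal.mul_le.2 fun _ hx _ hy => clsComap_mul_mem B hx hy

theorem clsIdeal_zero (B : Subalgebra R (GI I)) : clsIdeal B 0 = ⊤ :=
  (Ideal.eq_top_iff_one _).2 ⟨mem_zero _ _, B.one_mem⟩

/-- The ideals `clsIdeal B n` are multiplicative in `n`, so containment in the unit degrees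
propagates to all products of powers. -/
theorem multiPow_le_clsIdeal (B : Subalgebra R (GI I))
    (h : ∀ i, I i ≤ clsIdeal B (Pi.single i 1)) (n : Fin s → ℕ) :
    multiPow I (toZ n) ≤ clsIdeal B n := by
  have hpow : ∀ i (k : ℕ), I i ^ k ≤ clsIdeal B (Pi.single i k) := by
    intro i k
    induction k with
    | zero => rw [Pi.single_zero, clsIdeal_zero]; exact le_top
    | succ k ih =>
      rw [pow_succ, Pi.single_add]
      exact (Ideal.mul_mono ih (h i)).trans (clsIdeal_mul_le B _ _)
  have hprod : ∀ S : Finset (Fin s),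
      ∏ i ∈ S, I i ^ n i ≤ clsIdeal B (∑ i ∈ S, Pi.single i (n i)) := by
    intro S
    induction S using Finset.induction_on with
    | empty => rw [Finset.sum_empty, clsIdeal_zero]; exact le_top
    | insert i S hi ih =>
      rw [Finset.prod_insert hi, Finset.sum_insert hi]
      exact (Ideal.mul_mono (hpow i _) ih).trans (clsIdeal_mul_le B _ _)
  have := hprod Finset.univ
  rw [Finset.univ_sum_single] at this
  simpa [multiPow, toZ] using this

theorem mem_powFiltration_single {i : Fin s} {x : R} (hx : x ∈ I i) :
    x ∈ powFiltration I (toZ (Pi.single i 1)) := by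
  have : powFiltration I (toZ (Pi.single i 1)) = I i := by
    change ∏ j, I j ^ ((Pi.single i 1 : Fin s → ℕ) j : ℤ).toNat = _
    rw [Finset.prod_eq_single i (fun j _ hj => by simp [hj]) (by simp)]
    simp
  rwa [this]

instance finiteType_GI [IsNoetherianRing R] : Algebra.FiniteType R (GI I) := by
  classical
  choose S hS using fun i => IsNoetherian.noetherian (I i)
  have hSI : ∀ i, ∀ x ∈ S i, x ∈ I i := fun i x hx => hS i ▸ Submodule.subset_span hx
  let T : Set (GI I) := Set.range fun p : Σ i, S i =>
    DirectSum.of (powFiltration I).piece (Pi.single p.1 1)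
      ((powFiltration I).cls _ p.2.1 (mem_powFiltration_single (hSI _ _ p.2.2)))
  refine ⟨Subalgebra.fg_def.2 ⟨T, Set.finite_range _, ?_⟩⟩
  have hle : ∀ i, I i ≤ clsIdeal (Algebra.adjoin R T) (Pi.single i 1) := fun i => by
    rw [← hS i]
    refine Submodule.span_le.2 fun x hx => ?_
    exact ⟨mem_powFiltration_single (hSI i x hx), Algebra.subset_adjoin ⟨⟨i, x, hx⟩, rfl⟩⟩
  have := eq_top_of_le_clsComap (powFiltration I) (B := clsSubmonoid (Algebra.adjoin R T))
    fun n x hx => multiPow_le_clsIdeal _ hle n hx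
  exact Algebra.eq_top_iff.2 fun z => AddSubmonoid.eq_top_iff' _ |>.1 this z

instance isNoetherianRing_GI [IsNoetherianRing R] : IsNoetherianRing (GI I) :=
  Algebra.FiniteType.isNoetherianRing R (GI I)

/-! ### Finiteness of G(F) and powers of the reduction ideal -/

namespace Filtration

/-- The nonnegative part of a multidegree. -/
def posPart (c : Fin s → ℤ) : Fin s → ℕ := fun i => (c i).toNat

theorem toZ_posPart (c : Fin s → ℤ) : toZ (posPart c) = c ⊔ 0 := by
  funext i; simp [toZ, posPart]

theorem IsAdmissible.mem_of_le_posPart {F : Filtration I} (hF : F.IsAdmissible) {c : Fin s → ℤ}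
    {k : Fin s → ℕ} (hk : k ≤ posPart c) {x : R} (hx : x ∈ F c) : x ∈ F (toZ k) := by
  rw [hF.eq_pos, ← toZ_posPart] at hx
  exact F.anti _ _ (fun i => Int.ofNat_le.2 (hk i)) hx

/-- Finiteness descends from the extended Rees rings by comparing coefficients of t^n. A coefficient
in degree `c` must be available in every degree `k ≤ posPart c`, since the cofactor may have
negative exponents; there are finitely many such `k`. -/
theorem IsAdmissible.finite_G {F : Filtration I} (hF : F.IsAdmissible) :
    Module.Finite (GI I) F.G := by
  classical
  let φ := (Subalgebra.inclusion F.extRees_pow_le).toRingHom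
  let : Module (powFiltration I).extRees F.extRees := φ.toModule
  obtain ⟨S, hS⟩ := (hF.finite : Module.Finite (powFiltration I).extRees F.extRees).fg_top
  let T : Set F.G := Set.range
    fun p : Σ g : S, Σ c : g.1.1.coeff.support, Finset.Iic (posPart c.1) =>
      DirectSum.of F.piece p.2.2.1 (F.cls p.2.2.1 (p.1.1.1.coeff p.2.1.1)
        (hF.mem_of_le_posPart (Finset.mem_Iic.1 p.2.2.2) (p.1.1.2 p.2.1.1)))
  refine ⟨Submodule.fg_def.2 ⟨T, Set.finite_range _, ?_⟩⟩
  have key := F.eq_top_of_le_clsComap (B := (Submodule.span (GI I) T).toAddSubmonoid) ?_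
  · exact Submodule.eq_top_iff'.2 fun z => (AddSubmonoid.eq_top_iff' _).1 key z
  intro n x hx
  let p : F.extRees := ⟨AddMonoidAlgebra.single (toZ n) x, fun m => by
    rw [AddMonoidAlgebra.coeff_single, Finsupp.single_apply]
    split_ifs with h
    · exact h ▸ hx
    · exact Ideal.zero_mem _⟩
  obtain ⟨b, -, hb⟩ := Submodule.mem_span_finset.1
    (hS ▸ Submodule.mem_top : p ∈ Submodule.span (powFiltration I).extRees (S : Set F.extRees))
  have hb' : ∑ g ∈ S, (b g).1 * g.1 = p.1 := by
    rw [← hb, AddSubmonoidClass.coe_finsetSum]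
    rfl
  have hx' : x = ∑ g ∈ S, ((b g).1 * g.1).coeff (toZ n) := by
    have : p.1.coeff (toZ n) = x := by simp [p]
    rw [← this, ← hb', AddMonoidAlgebra.coeff_sum, Finsupp.finsetSum_apply]
  rw [hx']
  refine AddSubmonoid.sum_mem _ fun g hg => ?_
  rw [AddMonoidAlgebra.coeff_mul]
  refine AddSubmonoid.sum_mem _ fun u _ => AddSubmonoid.sum_mem _ fun c hc => ?_
  dsimp only
  split_ifs with huc
  swap
  · exact AddSubmonoid.zero_mem _
  -- Here `u + c = n`. Truncating `c` to lie between 0 and `n` keeps `n - k` natural, and `n - k` is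
  -- at most the positive part of `u` in each coordinate, so the cofactor lies in I^(n-k).
  set k : Fin s → ℕ := posPart c ⊓ n with hk
  have hu : (b g).1.coeff u ∈ powFiltration I (toZ (n - k)) := by
    have hle : multiPow I u ≤ multiPow I (toZ (n - k)) := by
      refine Finset.prod_le_prod' fun i _ => Ideal.pow_le_pow_right ?_
      have := congrFun huc i
      simp only [Pi.add_apply, toZ] at this
      simp only [toZ, Pi.sub_apply, hk, Pi.inf_apply, posPart]
      omega
    exact hle ((b g).2 u)
  have hgc : g.1.coeff c ∈ F (toZ k) := hF.mem_of_le_posPart inf_le_left (g.2 c)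
  have hkn : n - k + k = n := tsub_add_cancel_of_le inf_le_right
  have hmem : (b g).1.coeff u * g.1.coeff c ∈ F (toZ n) := by
    have := F.add_mem hu hgc
    rwa [hkn] at this
  refine ⟨hmem, ?_⟩
  have hsmul := F.of_cls_smul hu hgc
  rw [F.of_cls_congr hkn rfl _ hmem] at hsmul
  rw [← hsmul]
  exact Submodule.smul_mem _ _ (Submodule.subset_span
    ⟨⟨⟨g, hg⟩, ⟨c, hc⟩, ⟨k, Finset.mem_Iic.2 inf_le_left⟩⟩, rfl⟩)

theorem IsCompleteReduction.of_mem_powSmulTop {d : ℕ} {F : Filtration I}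
    {a : Fin s → Fin d → R} (ha : F.IsCompleteReduction a) :
    ∃ m : Fin s → ℕ, ∀ (q : ℕ) (n : Fin s → ℕ), m ≤ n → ∀ z : F.piece (q • 1 + n),
      DirectSum.of F.piece (q • 1 + n) z ∈
        powSmulTop (A := GI I) F.G (Ideal.span (Set.range (yStar ha.mem))) q := by
  obtain ⟨m, hm⟩ := ha.exists_eq
  refine ⟨m, fun q n hn => ?_⟩
  set J := Ideal.span (Set.range (yStar ha.mem))
  induction q with
  | zero =>
    intro z
    exact mem_powSmulTop_zero (A := GI I) J _
  | succ q ih =>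
    have hle : toZ m ≤ toZ (q • 1 + n) := fun i => by
      have := hn i
      simp only [toZ, Pi.add_apply, Nat.cast_le]
      exact this.trans (Nat.le_add_left _ _)
    have hdeg : 1 + (q • 1 + n) = (q + 1) • 1 + n := by
      rw [succ_nsmul']; abel
    rw [← hdeg]
    intro z
    obtain ⟨x, hx, rfl⟩ := F.cls_surj z
    set B : Submodule (GI I) F.G := powSmulTop (A := GI I) F.G J (q + 1)
    -- The condition is additive in `x`, so it may be checked on products of a reduction element
    -- with an element of F(qe + n).
    suffices h : x ∈ F.clsComap B.toAddSubmonoid (1 + (q • 1 + n)) from h.2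
    have hx' : x ∈ Ideal.span (Set.range fun j => ∏ i, a i j) * F (toZ (q • 1 + n)) := by
      rw [hm _ hle]
      rwa [toZ_add, toZ_one, add_comm] at hx
    refine Submodule.mul_induction_on hx' (fun r hr w hw => ?_) fun _ _ => AddSubmonoid.add_mem _
    obtain ⟨c, rfl⟩ := Ideal.mem_span_range_iff_exists_fun.1 hr
    rw [Finset.sum_mul]
    refine AddSubmonoid.sum_mem _ fun j _ => ?_
    have hcw : c j * w ∈ F (toZ (q • 1 + n)) := Ideal.mul_mem_left _ _ hw
    rw [show c j * (∏ i, a i j) * w = (∏ i, a i j) * (c j * w) by ring]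
    refine ⟨F.add_mem (prod_mem_multiPow ha.mem j) hcw, ?_⟩
    rw [← F.of_cls_smul (prod_mem_multiPow ha.mem j) hcw]
    have hj : yStar ha.mem j ∈ J := Ideal.subset_span ⟨j, rfl⟩
    exact smul_mem_powSmulTop_succ (A := GI I) hj (ih _)

theorem toGI_mul_mem_comp {n : Fin s → ℕ} (r : R) {x : GI I}
    (hx : x ∈ (powFiltration I).comp n) : toGI I r * x ∈ (powFiltration I).comp n := by
  obtain ⟨z, rfl⟩ := hx
  obtain ⟨x, hx, rfl⟩ := cls_surj _ z
  refine ⟨(powFiltration I).cls n (r * x) (Ideal.mul_mem_left _ _ hx), ?_⟩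
  refine Eq.trans ?_ (of_cls_smul (powFiltration I) (mem_zero _ r) hx).symm
  exact of_cls_congr _ (zero_add n).symm rfl _ _

end Filtration

end MultiFilt

end

/-! ### The main theorem -/

theorem theorem3p6 {R : Type*} [CommRing R] [IsNoetherianRing R] [IsLocalRing R]
    [Infinite (IsLocalRing.ResidueField R)] {d : ℕ} (hd : ringKrullDim R = d) (hd1 : 1 ≤ d)
    {s : ℕ} (hs : 1 ≤ s) (I : Fin s → Ideal R)
    (hI : ∀ i, MultiFilt.IsPrimaryTo (I i) (IsLocalRing.maximalIdeal R))
    (hgrade : 1 ≤ MultiFilt.grade (∏ i, I i))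
    (F : MultiFilt.Filtration I) (hF : F.IsAdmissible)
    (a : Fin s → Fin d → R) (ha : F.IsCompleteReduction a) :
    ∃ f : Fin d → MultiFilt.GI I,
      (∀ j, f j ∈ Ideal.span (Set.range (MultiFilt.yStar ha.mem)) ∧
        f j ∈ (MultiFilt.powFiltration I).comp 1) ∧
      MultiFilt.IsFilterRegularSeq (MultiFilt.powFiltration I).comp F.comp f ∧
      Ideal.span (Set.range (MultiFilt.yStar ha.mem)) = Ideal.span (Set.range f) := by
  have := hF.finite_G
  obtain ⟨f, hf, hspan, hreg⟩ :=
    MultiFilt.exists_generating_generic_sequence (R := R) (A := MultiFilt.GI I) (M := F.G)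
      (MultiFilt.yStar ha.mem)
  have hcomp : ∀ j, f j ∈ (MultiFilt.powFiltration I).comp 1 := fun j => by
    obtain ⟨c, hc⟩ := hf j
    rw [hc]
    exact AddSubgroup.sum_mem _ fun k _ =>
      MultiFilt.Filtration.toGI_mul_mem_comp _ ⟨_, rfl⟩
  refine ⟨f, fun j => ⟨hspan ▸ Ideal.subset_span ⟨j, rfl⟩, hcomp j⟩, fun i => ⟨⟨1, hcomp i⟩, ?_⟩,
    hspan⟩
  obtain ⟨q, hq⟩ := hreg i
  obtain ⟨m, hm⟩ := ha.of_mem_powSmulTop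
  -- `q` is the Artin–Rees exponent for `f i` and `m` the degree where the reduction equation
  -- starts; beyond qe + m each component lies in J^q G(F), and so does its image in the quotient.
  refine ⟨q • 1 + m, fun n hn x hx => hq x ?_⟩
  obtain ⟨l, rfl⟩ : ∃ l, n = q • 1 + (m + l) := by
    obtain ⟨l, rfl⟩ := exists_add_of_le hn
    exact ⟨l, add_assoc _ _ _⟩
  obtain ⟨_, ⟨z, rfl⟩, rfl⟩ := hx
  exact MultiFilt.mkQ_mem_powSmulTop (A := MultiFilt.GI I) _ (hm q (m + l) le_self_add z)
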